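/- Let $\mathbf{F}_q$ be a finite field with $q$ elements. For integers $m,\nu\ge 0$ let $\mathcal{R}_q(\nu,m)\subseteq \mathbf{F}_q^{\,q^m}$ be the generalized Reed-Muller code of order $\nu$, that is, the set of all vectors $(f(P))_{P\in \mathbf{F}_q^m}$, where $f$ runs through the polynomials in $\mathbf{F}_q[x_1,\dots,x_m]$ of total degree at most $\nu$. Let $k(\nu)$ be its dimension, let $d(\nu)$ be its minimum distance (the least Hamming weight of a nonzero codeword), and put $\nu^\perp=m(q-1)-1-\nu$ for $0\le\nu\le m(q-1)-1$. A quantum stabilizer code with parameters $[[n,k,d]]_q$ is a subspace of $(\mathbf{C}^q)^{\otimes n}$ of dimension $q^k$ that is the joint $+1$-eigenspace of an abelian subgroup of the error group generated by $\omega=e^{2\pi i/p}$ ($p$ the characteristic of $\mathbf{F}_q$) and the operators $X(a):|x\rangle\mapsto|x+a\rangle$ and $Z(b):|x\rangle\mapsto\omega^{\mathrm{tr}(b\cdot x)}|x\rangle$ for $a,b\in\mathbf{F}_q^n$, and whose minimum distance is $d$. Here the minimum distance is the least weight of an error $X(a)Z(b)$ that the code does not detect. If the code has dimension $1$, it is instead,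 as usual, the least weight of an error $E=X(a)Z(b)$ with $(a,b)\neq(0,0)$ for which $\langle u|E|v\rangle\ne0$ for some $u,v$ in the code. The minimum over the empty set, which only occurs for $n=0$, is $\infty$. **Theorem.** Let $\nu_1,\nu_2,\mu$ be integers with $0\le\nu_1\le\nu_2\le m(q-1)-1$ and $0\le\mu\le\nu_2-\nu_1$, and put $d=\min\{d(\nu_2),d(\nu_1^\perp)\}$. If $\mathcal{R}_q(\mu,m)$ has a codeword of Hamming weight $r$, then there exists a quantum stabilizer code with parameters $[[r,k',d']]_q$ for some integer $k'\ge 0$ with $k'\ge k(\nu_2)-k(\nu_1)-q^m+r$ and some $d'\ge d$. In particular, there exists a quantum stabilizer code with parameters $[[d(\mu),k',d']]_q$ for some integer $k'\ge 0$ with $k'\ge k(\nu_2)-k(\nu_1)-q^m+d(\mu)$ and some $d'\ge d$. -/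

import Mathlib

/-! ### Classical codes -/

/-- The generalized Reed-Muller code of order `ν` in `m` variables over the finite field `F`:
the evaluation vectors, at all points of `F ^ m`, of the polynomials of total degree at most `ν`.
Coordinates are indexed by the points themselves. -/
noncomputable def grmCode (F : Type*) [Field F] (m ν : ℕ) :
    Submodule F ((Fin m → F) → F) :=
  (MvPolynomial.restrictTotalDegree (Fin m) F ν).map (MvPolynomial.evalₗ F (Fin m))

/-- The dimension `k(ν)` of the generalized Reed-Muller code of order `ν`. -/
noncomputable def grmDim (F : Type*) [Field F] (m ν : ℕ) : ℕ :=
  Module.finrank F (grmCode F m ν)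

/-- The minimum distance of a linear code: the least Hamming weight of a nonzero codeword. -/
noncomputable def codeMinDist {F ι : Type*} [Field F] [DecidableEq F] [Fintype ι]
    (C : Submodule F (ι → F)) : ℕ :=
  sInf {w : ℕ | ∃ c ∈ C, c ≠ 0 ∧ hammingNorm c = w}

/-- The minimum distance `d(ν)` of the generalized Reed-Muller code of order `ν`. -/
noncomputable def grmDist (F : Type*) [Field F] [Fintype F] [DecidableEq F] (m ν : ℕ) : ℕ :=
  codeMinDist (grmCode F m ν)

/-- The dual order `ν^⊥ = m(q-1) - 1 - ν` (used only for `ν < m(q-1)`). -/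
def grmDualOrder (F : Type*) [Fintype F] (m ν : ℕ) : ℕ :=
  m * (Fintype.card F - 1) - 1 - ν

/-! ### Quantum stabilizer codes -/

/-- The state space of `n` qudits of dimension `q = |F|`, that is `(ℂ^q)^{⊗ n}`, written in
coordinates with respect to the orthonormal basis `|x⟩`, `x ∈ F ^ n`. -/
abbrev QuditSpace (F : Type*) (n : ℕ) : Type _ := EuclideanSpace ℂ (Fin n → F)

/-- The value `ω ^ j`, where `ω = exp(2πi/p)` and `p` is the characteristic of `F`. -/
noncomputable def rootPow (F : Type*) [Field F] [Fintype F] (j : ZMod (ringChar F)) : ℂ :=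
  haveI : NeZero (ringChar F) := ⟨CharP.ringChar_ne_zero_of_finite F⟩
  ZMod.stdAddChar j

/-- The canonical additive character `x ↦ ω ^ tr(x)` of `F`, where `tr` is the absolute trace. -/
noncomputable def traceChar (F : Type*) [Field F] [Fintype F] (x : F) : ℂ :=
  letI : Algebra (ZMod (ringChar F)) F := ZMod.algebra F (ringChar F)
  rootPow F (Algebra.trace (ZMod (ringChar F)) F x)

/-- The shift error `X(a) : |x⟩ ↦ |x + a⟩`. -/
noncomputable def shiftOp {F : Type*} [Field F] [Fintype F] {n : ℕ} (a : Fin n → F) :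
    QuditSpace F n →ₗ[ℂ] QuditSpace F n where
  toFun v := WithLp.toLp 2 (fun x => v (x - a))
  map_add' u v := by ext x; simp
  map_smul' c v := by ext x; simp

/-- The phase error `Z(b) : |x⟩ ↦ ω ^ tr(b ⬝ x) |x⟩`. -/
noncomputable def phaseOp {F : Type*} [Field F] [Fintype F] {n : ℕ} (b : Fin n → F) :
    QuditSpace F n →ₗ[ℂ] QuditSpace F n where
  toFun v := WithLp.toLp 2 (fun x => traceChar F (b ⬝ᵥ x) * v x)
  map_add' u v := by ext x; simp [mul_add]
  map_smul' c v := by ext x; simp [mul_left_comm]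

/-- The error operator `X(a) Z(b)`. -/
noncomputable def errorOp {F : Type*} [Field F] [Fintype F] {n : ℕ} (a b : Fin n → F) :
    QuditSpace F n →ₗ[ℂ] QuditSpace F n :=
  shiftOp a ∘ₗ phaseOp b

/-- The weight of `X(a) Z(b)`: the number of qudits on which it acts nontrivially. -/
def errorWeight {F : Type*} [Field F] [DecidableEq F] {n : ℕ} (a b : Fin n → F) : ℕ :=
  (Finset.univ.filter (fun i => a i ≠ 0 ∨ b i ≠ 0)).card

/-- Membership in the error group `{ω ^ j X(a) Z(b)}`. -/
def IsErrorGroupElement {F : Type*} [Field F] [Fintype F] {n : ℕ}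
    (E : QuditSpace F n →ₗ[ℂ] QuditSpace F n) : Prop :=
  ∃ (j : ZMod (ringChar F)) (a b : Fin n → F), E = rootPow F j • errorOp a b

/-- A stabilizer code: a nonzero subspace that is the joint eigenspace with eigenvalue `1` of all
elements of an abelian subgroup of the error group. -/
def IsStabilizerCode {F : Type*} [Field F] [Fintype F] {n : ℕ}
    (Q : Submodule ℂ (QuditSpace F n)) : Prop :=
  Q ≠ ⊥ ∧ ∃ S : Subgroup (QuditSpace F n ≃ₗ[ℂ] QuditSpace F n),
    (∀ g ∈ S, IsErrorGroupElement (g : QuditSpace F n →ₗ[ℂ] QuditSpace F n)) ∧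
    (∀ g ∈ S, ∀ h ∈ S, g * h = h * g) ∧
    ∀ v : QuditSpace F n, v ∈ Q ↔ ∀ g ∈ S, g v = v

/-- The code `Q` detects the error `E`: there is a scalar `c` with `⟨u|E|v⟩ = c ⟨u|v⟩` for all
states `u`, `v` of the code. -/
def Detects {F : Type*} [Field F] [Fintype F] {n : ℕ}
    (Q : Submodule ℂ (QuditSpace F n)) (E : QuditSpace F n →ₗ[ℂ] QuditSpace F n) : Prop :=
  ∃ c : ℂ, ∀ u ∈ Q, ∀ v ∈ Q, inner ℂ u (E v) = c * inner ℂ u v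

/-- The errors `X(a) Z(b)` that count for the minimum distance. In general these are the errors
that the code does not detect. A code of dimension one detects everything; for it one takes, by the
usual convention, the errors other than the identity that do not map `Q` to its orthogonal
complement (so such a code of distance `d` is pure to `d`). -/
def IsHarmful {F : Type*} [Field F] [Fintype F] {n : ℕ}
    (Q : Submodule ℂ (QuditSpace F n)) (a b : Fin n → F) : Prop :=
  (Module.finrank ℂ Q ≠ 1 ∧ ¬ Detects Q (errorOp a b)) ∨
  (Module.finrank ℂ Q = 1 ∧ (a ≠ 0 ∨ b ≠ 0) ∧
    ∃ u ∈ Q, ∃ v ∈ Q, inner ℂ u (errorOp a b v) ≠ 0)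

/-- The minimum distance of a quantum code: the least weight of a harmful error
(`⊤` if there is none, which for stabilizer codes only happens in length `0`). -/
noncomputable def quantumMinDist {F : Type*} [Field F] [Fintype F] [DecidableEq F] {n : ℕ}
    (Q : Submodule ℂ (QuditSpace F n)) : ℕ∞ :=
  ⨅ (a : Fin n → F) (b : Fin n → F) (_ : IsHarmful Q a b), (errorWeight a b : ℕ∞)

/-- There is a quantum stabilizer code with parameters `[[n, k, d]]_q`, `q = |F|`: length `n`,
dimension `q ^ k` and minimum distance `d`. -/
def ExistsStabilizerCode (F : Type*) [Field F] [Fintype F] [DecidableEq F]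
    (n k : ℕ) (d : ℕ∞) : Prop :=
  ∃ Q : Submodule ℂ (QuditSpace F n), IsStabilizerCode Q ∧
    Module.finrank ℂ Q = Fintype.card F ^ k ∧ quantumMinDist Q = d

/-!
The quantum code comes from a codeword `c` of `R(μ)` with support `S`, `|S| = r`. Let `A` be the
code on `S` of the words `(a c)|_S` with `a ∈ R(ν₁)`, and `B` that of the words `b|_S` with
`b ∈ R(ν₂)^⊥`. Degrees add under multiplication, so `a c ∈ R(ν₂)`, hence `A` and `B` are
orthogonal, and the errors `X(a) Z(b)` with `a ∈ A`, `b ∈ B` form an abelian group. Its fixed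
states are the functions on `F ^ S` that are supported on `B^⊥` and invariant under `A`, that is,
the functions on `B^⊥ / A` (`cssEquiv`); so the dimension exponent is `r - dim A - dim B`, and
`dim A ≤ k(ν₁)`, `dim B ≤ q ^ m - k(ν₂)`.

An error counting for the minimum distance is not the identity and has its shift part in `B^⊥` and
its phase part in `A^⊥` (`IsHarmful.mem_dualCode`), because every other error maps the code to its
orthogonal complement. A word of `B^⊥` extends by zero to a word of `R(ν₂)^⊥⊥ = R(ν₂)`. A word of
`A^⊥`, multiplied by `c`, extends by zero to a word of `R(ν₁)^⊥`, which lies in `R(ν₁^⊥)`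
(`dualCode_grmCode_le`). Nonzero words of both kinds therefore have weight at least
`min {d(ν₂), d(ν₁^⊥)}`.
-/

/-! ### Dual codes -/

/-- The dual of a linear code with respect to the dot product. -/
def dualCode {F ι : Type*} [Field F] [Fintype ι] (D : Submodule F (ι → F)) :
    Submodule F (ι → F) where
  carrier := {x | ∀ y ∈ D, y ⬝ᵥ x = 0}
  add_mem' hx hy z hz := by rw [dotProduct_add, hx z hz, hy z hz, add_zero]
  zero_mem' _ _ := dotProduct_zero _
  smul_mem' c x hx z hz := by rw [dotProduct_smul, hx z hz, smul_zero]

section DualCode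

variable {F ι : Type*} [Field F] [Fintype ι]

theorem mem_dualCode {D : Submodule F (ι → F)} {x : ι → F} :
    x ∈ dualCode D ↔ ∀ y ∈ D, y ⬝ᵥ x = 0 := Iff.rfl

theorem finrank_add_finrank_dualCode (D : Submodule F (ι → F)) :
    Module.finrank F D + Module.finrank F (dualCode D) = Fintype.card ι := by
  classical
  have h : dualCode D =
      (D.map (dotProductEquiv F ι : (ι → F) →ₗ[F] _)).dualCoannihilator := by
    ext x
    rw [mem_dualCode, Submodule.mem_dualCoannihilator]
    exact (Set.forall_mem_image (f := dotProductEquiv F ι) (s := (D : Set (ι → F)))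
      (p := fun φ => φ x = 0)).symm
  rw [h, ← LinearEquiv.finrank_map_eq (dotProductEquiv F ι) D,
    Subspace.finrank_add_finrank_dualCoannihilator_eq, Module.finrank_fintype_fun_eq_card]

theorem dualCode_dualCode (D : Submodule F (ι → F)) : dualCode (dualCode D) = D := by
  symm
  apply Submodule.eq_of_le_of_finrank_eq
  · intro x hx y hy
    rw [dotProduct_comm]
    exact hy x hx
  · have h₁ := finrank_add_finrank_dualCode D
    have h₂ := finrank_add_finrank_dualCode (dualCode D)
    omega

/-- A word of the dual of a punctured code, extended by zero, is a word of the dual code. -/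
theorem extend_mem_dualCode {κ : Type*} [Fintype κ] (e : κ ↪ ι) {D : Submodule F (ι → F)}
    {x : κ → F} (hx : ∀ y ∈ D, (y ∘ e) ⬝ᵥ x = 0) :
    Function.extend e x 0 ∈ dualCode D := by
  intro y hy
  rw [← hx y hy]
  refine (Fintype.sum_of_injective e e.injective _ _ (fun i hi => ?_) fun j => ?_).symm
  · rw [Function.extend_apply' _ _ _ hi, Pi.zero_apply, mul_zero]
  · rw [e.injective.extend_apply, Function.comp_apply]

end DualCode

theorem codeMinDist_le {F ι : Type*} [Field F] [DecidableEq F] [Fintype ι]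
    {C : Submodule F (ι → F)} {c : ι → F} (hc : c ∈ C) (h0 : c ≠ 0) :
    codeMinDist C ≤ hammingNorm c :=
  Nat.sInf_le ⟨c, hc, h0, rfl⟩

theorem hammingNorm_extend_zero {F ι κ : Type*} [Zero F] [DecidableEq F] [Fintype ι] [Fintype κ]
    (e : κ ↪ ι) (x : κ → F) : hammingNorm (Function.extend e x 0) = hammingNorm x := by
  classical
  rw [hammingNorm, hammingNorm, ← Finset.card_map e]
  congr 1
  ext i
  simp only [Finset.mem_filter, Finset.mem_univ, true_and, Finset.mem_map]
  constructor
  · intro h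
    by_cases hi : ∃ j, e j = i
    · obtain ⟨j, rfl⟩ := hi
      rw [e.injective.extend_apply] at h
      exact ⟨j, h, rfl⟩
    · rw [Function.extend_apply' _ _ _ hi] at h
      exact absurd rfl h
  · rintro ⟨j, hj, rfl⟩
    rwa [e.injective.extend_apply]

/-! ### Generalized Reed-Muller codes -/

section ReedMuller

variable {F : Type*} [Field F] {m : ℕ}

theorem mem_grmCode {ν : ℕ} {c : (Fin m → F) → F} :
    c ∈ grmCode F m ν ↔
      ∃ f : MvPolynomial (Fin m) F, f.totalDegree ≤ ν ∧ ∀ P, MvPolynomial.eval P f = c P := by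
  simp only [grmCode, Submodule.mem_map, MvPolynomial.mem_restrictTotalDegree, funext_iff,
    MvPolynomial.evalₗ_apply]

theorem mul_mem_grmCode {ν μ κ : ℕ} (h : ν + μ ≤ κ) {a c : (Fin m → F) → F}
    (ha : a ∈ grmCode F m ν) (hc : c ∈ grmCode F m μ) : a * c ∈ grmCode F m κ := by
  obtain ⟨f, hf, hfa⟩ := mem_grmCode.1 ha
  obtain ⟨g, hg, hgc⟩ := mem_grmCode.1 hc
  refine mem_grmCode.2 ⟨f * g, (MvPolynomial.totalDegree_mul f g).trans (by omega), fun P => ?_⟩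
  rw [map_mul, hfa, hgc, Pi.mul_apply]

theorem one_mem_grmCode (ν : ℕ) : (1 : (Fin m → F) → F) ∈ grmCode F m ν :=
  mem_grmCode.2 ⟨1, by simp, by simp⟩

theorem exists_mem_grmCode_hammingNorm_eq_grmDist [Fintype F] [DecidableEq F] (ν : ℕ) :
    ∃ c ∈ grmCode F m ν, hammingNorm c = grmDist F m ν := by
  obtain ⟨c, hc, -, h⟩ := Nat.sInf_mem
    (s := {w : ℕ | ∃ c ∈ grmCode F m ν, c ≠ 0 ∧ hammingNorm c = w})
    ⟨_, 1, one_mem_grmCode ν, one_ne_zero, rfl⟩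
  exact ⟨c, hc, h⟩

theorem sum_pow_card_sub_one_ne_zero (F : Type*) [Field F] [Fintype F] :
    ∑ x : F, x ^ (Fintype.card F - 1) ≠ 0 := by
  classical
  have hq : 1 < Fintype.card F := Fintype.one_lt_card
  have h : ∀ x ∈ Finset.univ.erase (0 : F), x ^ (Fintype.card F - 1) = 1 := fun x hx =>
    FiniteField.pow_card_sub_one_eq_one x (Finset.ne_of_mem_erase hx)
  rw [← Finset.add_sum_erase _ _ (Finset.mem_univ (0 : F)), zero_pow (by omega), zero_add,
    Finset.sum_congr rfl h, Finset.sum_const, Finset.card_erase_of_mem (Finset.mem_univ _),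
    Finset.card_univ, nsmul_one, Nat.cast_sub hq.le, FiniteField.cast_card_eq_zero]
  simp

/-- The sum over all points of `F ^ m` of a polynomial times a monomial splits into products of
power sums in one variable. -/
theorem sum_eval_mul_prod_pow [Fintype F] (f : MvPolynomial (Fin m) F) (k : Fin m → ℕ) :
    ∑ P : Fin m → F, MvPolynomial.eval P f * ∏ i, P i ^ k i =
      ∑ d ∈ f.support, f.coeff d * ∏ i, ∑ x : F, x ^ (d i + k i) := by
  simp_rw [MvPolynomial.eval_eq', Finset.sum_mul]
  rw [Finset.sum_comm]
  refine Finset.sum_congr rfl fun d _ => ?_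
  rw [Finset.prod_univ_sum, Fintype.piFinset_univ, Finset.mul_sum]
  refine Finset.sum_congr rfl fun P _ => ?_
  simp_rw [pow_add]
  rw [Finset.prod_mul_distrib, mul_assoc]

/-- The inclusion `R(ν)^⊥ ⊆ R(ν^⊥)`: if the reduced polynomial `f` of a word has a monomial of
maximal degree, with exponents `e i`, and that degree exceeds `ν^⊥`, then the monomial with
exponents `q - 1 - e i` has degree at most `ν` and is not orthogonal to `f`. -/
theorem dualCode_grmCode_le [Fintype F] {ν : ℕ} (hν : ν + 1 ≤ m * (Fintype.card F - 1)) :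
    dualCode (grmCode F m ν) ≤ grmCode F m (grmDualOrder F m ν) := by
  intro b hb
  set q := Fintype.card F with hq
  have hb' : b ∈ (MvPolynomial.restrictDegree (Fin m) F (q - 1)).map
      (MvPolynomial.evalₗ F (Fin m)) := by
    rw [MvPolynomial.map_restrict_dom_evalₗ]
    trivial
  obtain ⟨f, hf, rfl⟩ := hb'
  refine mem_grmCode.2 ⟨f, ?_, fun P => rfl⟩
  rw [SetLike.mem_coe, MvPolynomial.mem_restrictDegree] at hf
  by_contra! hdeg
  unfold grmDualOrder at hdeg
  rw [← hq] at hdeg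
  have hf0 : f.support.Nonempty := by
    rw [Finset.nonempty_iff_ne_empty, Ne, MvPolynomial.support_eq_empty]
    rintro rfl
    simp at hdeg
  obtain ⟨e, he, hedeg⟩ := Finset.exists_mem_eq_sup f.support hf0
    (fun s => s.sum fun _ n => n)
  change f.totalDegree = _ at hedeg
  rw [Finsupp.sum_fintype _ _ (fun _ => rfl)] at hedeg
  have hsum : ∑ i, (q - 1 - e i) + ∑ i, e i = m * (q - 1) := by
    rw [← Finset.sum_add_distrib, Finset.sum_congr rfl
      (fun i _ => Nat.sub_add_cancel (hf e he i))]
    simp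
  have hmem : (fun P : Fin m → F => ∏ i, P i ^ (q - 1 - e i)) ∈ grmCode F m ν := by
    refine mem_grmCode.2 ⟨∏ i, MvPolynomial.X i ^ (q - 1 - e i), ?_, fun P => by simp⟩
    refine (MvPolynomial.totalDegree_finsetProd _ _).trans ?_
    simp_rw [MvPolynomial.totalDegree_X_pow]
    omega
  have h0 := hb _ hmem
  rw [dotProduct_comm] at h0
  change ∑ P : Fin m → F, MvPolynomial.eval P f * ∏ i, P i ^ (q - 1 - e i) = 0 at h0
  rw [sum_eval_mul_prod_pow, Finset.sum_eq_single e] at h0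
  · rw [mul_eq_zero, Finset.prod_eq_zero_iff] at h0
    rcases h0 with h0 | ⟨i, -, h0⟩
    · exact MvPolynomial.mem_support_iff.1 he h0
    · rw [Nat.add_sub_cancel' (hf e he i)] at h0
      exact sum_pow_card_sub_one_ne_zero F h0
  · intro d hd hde
    -- As `d ≠ e` has at most the degree of `e`, it is smaller in some coordinate.
    have hlt : ∃ i, d i < e i := by
      by_contra! hle
      apply hde
      have hdd : ∑ i, d i ≤ ∑ i, e i := by
        rw [← hedeg, ← Finsupp.sum_fintype d (fun _ n => n) (fun _ => rfl)]
        exact MvPolynomial.le_totalDegree hd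
      have := (Finset.sum_eq_sum_iff_of_le fun i _ => hle i).1
        (le_antisymm (Finset.sum_le_sum fun i _ => hle i) hdd)
      ext i
      exact (this i (Finset.mem_univ i)).symm
    obtain ⟨i, hi⟩ := hlt
    have := hf e he i
    rw [Finset.prod_eq_zero (Finset.mem_univ i), mul_zero]
    exact FiniteField.sum_pow_lt_card_sub_one F _ (by omega)
  · exact fun h => absurd he h

end ReedMuller

/-! ### The error operators -/

section ErrorOperators

variable {F : Type*} [Field F] [Fintype F]

theorem traceChar_zero : traceChar F (0 : F) = 1 := by
  simp only [traceChar, rootPow, map_zero, AddChar.map_zero_eq_one]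

theorem traceChar_add (x y : F) : traceChar F (x + y) = traceChar F x * traceChar F y := by
  simp only [traceChar, rootPow, map_add, AddChar.map_add_eq_mul]

theorem conj_traceChar_mul_self (x : F) :
    (starRingEnd ℂ) (traceChar F x) * traceChar F x = 1 := by
  have : NeZero (ringChar F) := ⟨CharP.ringChar_ne_zero_of_finite F⟩
  simp only [traceChar, rootPow, ZMod.stdAddChar_apply]
  rw [Complex.conj_mul', Circle.norm_coe]
  simp

theorem exists_traceChar_mul_ne_one {x : F} (hx : x ≠ 0) : ∃ t : F, traceChar F (x * t) ≠ 1 := by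
  have : NeZero (ringChar F) := ⟨CharP.ringChar_ne_zero_of_finite F⟩
  let : Algebra (ZMod (ringChar F)) F := ZMod.algebra F (ringChar F)
  obtain ⟨t, ht⟩ := FiniteField.trace_to_zmod_nondegenerate F hx
  refine ⟨t, fun h => ht ?_⟩
  exact ZMod.injective_stdAddChar (h.trans (AddChar.map_zero_eq_one _).symm)

variable {n : ℕ}

theorem errorOp_apply (a b : Fin n → F) (v : QuditSpace F n) (x : Fin n → F) :
    errorOp a b v x = traceChar F (b ⬝ᵥ (x - a)) * v (x - a) := rfl

theorem errorOp_zero_zero : errorOp (0 : Fin n → F) 0 = LinearMap.id := by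
  ext v x
  simp [errorOp_apply, traceChar_zero]

theorem errorOp_comp_errorOp {a b a' b' : Fin n → F} (h : b ⬝ᵥ a' = 0) :
    errorOp a b ∘ₗ errorOp a' b' = errorOp (a + a') (b + b') := by
  ext v x
  have h₁ : x - (a + a') = x - a - a' := by abel
  have h₂ : b ⬝ᵥ (x - a) = b ⬝ᵥ (x - a - a') := by rw [dotProduct_sub b (x - a), h, sub_zero]
  rw [LinearMap.comp_apply, errorOp_apply, errorOp_apply, errorOp_apply, h₁, add_dotProduct,
    traceChar_add, h₂, mul_assoc]

/-- A word outside the dual of a linear code is seen by the trace character on that code. -/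
theorem exists_traceChar_dotProduct_ne_one {D : Submodule F (Fin n → F)} {x : Fin n → F}
    (hx : x ∉ dualCode D) : ∃ b ∈ D, traceChar F (b ⬝ᵥ x) ≠ 1 := by
  simp only [mem_dualCode, not_forall] at hx
  obtain ⟨y, hy, hyx⟩ := hx
  obtain ⟨t, ht⟩ := exists_traceChar_mul_ne_one hyx
  exact ⟨t • y, D.smul_mem t hy, by rwa [smul_dotProduct, smul_eq_mul, mul_comm]⟩

end ErrorOperators

/-! ### The code of an orthogonal pair of classical codes -/

section CSS

variable {F : Type*} [Field F] [Fintype F] {n : ℕ}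

/-- The Calderbank-Shor-Steane code of two classical codes `A` and `B`: the states that are
invariant under the shifts by words of `A` and supported on the dual of `B`. -/
def cssCode (A B : Submodule F (Fin n → F)) : Submodule ℂ (QuditSpace F n) where
  carrier := {v | (∀ a ∈ A, ∀ x, v (x - a) = v x) ∧ ∀ x ∉ dualCode B, v x = 0}
  add_mem' hu hv := ⟨fun a ha x => by simp [hu.1 a ha x, hv.1 a ha x],
    fun x hx => by simp [hu.2 x hx, hv.2 x hx]⟩
  zero_mem' := ⟨fun _ _ _ => rfl, fun _ _ => rfl⟩
  smul_mem' c v hv := ⟨fun a ha x => by simp [hv.1 a ha x], fun x hx => by simp [hv.2 x hx]⟩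

variable {A B : Submodule F (Fin n → F)}

theorem mem_cssCode {v : QuditSpace F n} :
    v ∈ cssCode A B ↔
      (∀ a ∈ A, ∀ x, v (x - a) = v x) ∧ ∀ x ∉ dualCode B, v x = 0 := Iff.rfl

theorem mem_cssCode_iff_errorOp {v : QuditSpace F n} :
    v ∈ cssCode A B ↔ ∀ a ∈ A, ∀ b ∈ B, errorOp a b v = v := by
  constructor
  · rintro ⟨hA, hB⟩ a ha b hb
    ext x
    rw [errorOp_apply, ← hA a ha x]
    by_cases hx : x - a ∈ dualCode B
    · rw [hx b hb, traceChar_zero, one_mul]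
    · rw [hB _ hx, mul_zero]
  · intro hv
    refine ⟨fun a ha x => ?_, fun x hx => ?_⟩
    · conv_rhs => rw [← hv a ha 0 B.zero_mem]
      rw [errorOp_apply, zero_dotProduct, traceChar_zero, one_mul]
    · obtain ⟨b, hb, hne⟩ := exists_traceChar_dotProduct_ne_one hx
      have := congrArg (fun w : QuditSpace F n => w x) (hv 0 A.zero_mem b hb)
      simp only [errorOp_apply, sub_zero] at this
      by_contra h0
      exact hne (mul_right_cancel₀ h0 (this.trans (one_mul _).symm))

/-- The abelian group of the errors `X(a) Z(b)` with `a ∈ A` and `b ∈ B`. -/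
def cssStabilizer (h : A ≤ dualCode B) :
    Subgroup (QuditSpace F n ≃ₗ[ℂ] QuditSpace F n) where
  carrier := {g | ∃ a ∈ A, ∃ b ∈ B, (g : QuditSpace F n →ₗ[ℂ] QuditSpace F n) = errorOp a b}
  one_mem' := ⟨0, A.zero_mem, 0, B.zero_mem, errorOp_zero_zero.symm⟩
  mul_mem' := by
    rintro g g' ⟨a, ha, b, hb, hg⟩ ⟨a', ha', b', hb', hg'⟩
    refine ⟨a + a', A.add_mem ha ha', b + b', B.add_mem hb hb', ?_⟩
    rw [← errorOp_comp_errorOp (h ha' b hb), ← hg, ← hg']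
    rfl
  inv_mem' := by
    rintro g ⟨a, ha, b, hb, hg⟩
    refine ⟨-a, A.neg_mem ha, -b, B.neg_mem hb, ?_⟩
    have hinv : errorOp (-a) (-b) ∘ₗ errorOp a b = LinearMap.id := by
      rw [errorOp_comp_errorOp (by rw [neg_dotProduct, h ha b hb, neg_zero]),
        neg_add_cancel, neg_add_cancel, errorOp_zero_zero]
    ext1 v
    have := LinearMap.congr_fun hinv (g⁻¹ v)
    rw [← hg] at this
    simp only [LinearMap.comp_apply, LinearEquiv.coe_coe, LinearMap.id_apply] at this
    rw [LinearEquiv.coe_coe, ← this]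
    congr 1
    exact g.apply_symm_apply v

theorem exists_cssStabilizer (h : A ≤ dualCode B) {a b : Fin n → F} (ha : a ∈ A) (hb : b ∈ B) :
    ∃ g ∈ cssStabilizer h, (g : QuditSpace F n →ₗ[ℂ] QuditSpace F n) = errorOp a b := by
  have hinv : ∀ a ∈ A, ∀ b ∈ B, errorOp a b ∘ₗ errorOp (-a) (-b) = LinearMap.id := by
    intro a ha b hb
    rw [errorOp_comp_errorOp (by rw [dotProduct_neg, h ha b hb, neg_zero]),
      add_neg_cancel, add_neg_cancel, errorOp_zero_zero]
  refine ⟨LinearEquiv.ofLinearMap (errorOp a b) (errorOp (-a) (-b)) (hinv a ha b hb) ?_,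
    ⟨a, ha, b, hb, rfl⟩, rfl⟩
  simpa using hinv (-a) (A.neg_mem ha) (-b) (B.neg_mem hb)

/-- Functions on `B^⊥ / A`, pulled back to `B^⊥` and extended by zero, are the states of the
code. -/
noncomputable def cssEquiv (h : A ≤ dualCode B) :
    ((dualCode B ⧸ A.submoduleOf (dualCode B)) → ℂ) ≃ₗ[ℂ] cssCode A B := by
  classical
  exact
  { toFun := fun f => ⟨WithLp.toLp 2 fun x =>
      if hx : x ∈ dualCode B then f (Submodule.Quotient.mk ⟨x, hx⟩) else 0, by
        refine mem_cssCode.2 ⟨fun a ha x => ?_, fun x hx => dif_neg hx⟩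
        have hiff : x - a ∈ dualCode B ↔ x ∈ dualCode B :=
          (dualCode B).sub_mem_iff_left (h ha)
        by_cases hx : x ∈ dualCode B
        · simp only [dif_pos hx, dif_pos (hiff.2 hx)]
          congr 1
          rw [Submodule.Quotient.eq]
          simpa [Submodule.submoduleOf] using ha
        · simp only [dif_neg hx, dif_neg (mt hiff.1 hx)]⟩
    map_add' := fun f g => by
      ext x
      by_cases hx : x ∈ dualCode B <;> simp [hx]
    map_smul' := fun c f => by
      ext x
      by_cases hx : x ∈ dualCode B <;> simp [hx]
    invFun := fun v => fun y => Quotient.liftOn' y (fun x => (v : QuditSpace F n) x) (by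
      intro x y hxy
      rw [Submodule.quotientRel_def] at hxy
      have := v.2.1 _ (show ((x - y : dualCode B) : Fin n → F) ∈ A from hxy) x
      simpa using this.symm)
    left_inv := fun f => by
      ext y
      induction y using Submodule.Quotient.induction_on with
      | _ x => exact dif_pos x.2
    right_inv := fun v => by
      ext x
      by_cases hx : x ∈ dualCode B
      · exact dif_pos hx
      · exact (dif_neg hx).trans (v.2.2 x hx).symm }

theorem finrank_cssCode (h : A ≤ dualCode B) :
    Module.finrank ℂ (cssCode A B) =
      Fintype.card F ^ (n - Module.finrank F A - Module.finrank F B) := by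
  have hB := finrank_add_finrank_dualCode B
  rw [Fintype.card_fin] at hB
  have hA : Module.finrank F (A.submoduleOf (dualCode B)) = Module.finrank F A :=
    (Submodule.submoduleOfEquivOfLe h).finrank_eq
  have hq := Submodule.finrank_quotient_add_finrank (A.submoduleOf (dualCode B))
  classical
  have := Fintype.ofFinite (dualCode B ⧸ A.submoduleOf (dualCode B))
  rw [← (cssEquiv h).finrank_eq, Module.finrank_fintype_fun_eq_card,
    Module.card_eq_pow_finrank (K := F)]
  congr 1
  omega

theorem isStabilizerCode_cssCode (h : A ≤ dualCode B) : IsStabilizerCode (cssCode A B) := by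
  refine ⟨fun hbot => ?_, cssStabilizer h, ?_, ?_, fun v => ?_⟩
  · have := finrank_cssCode h
    rw [hbot, finrank_bot] at this
    exact pow_ne_zero _ Fintype.card_ne_zero this.symm
  · rintro g ⟨a, -, b, -, hg⟩
    refine ⟨0, a, b, ?_⟩
    rw [hg, rootPow, AddChar.map_zero_eq_one, one_smul]
  · rintro g ⟨a, ha, b, hb, hg⟩ g' ⟨a', ha', b', hb', hg'⟩
    apply LinearEquiv.toLinearMap_injective
    change g.toLinearMap ∘ₗ g'.toLinearMap = g'.toLinearMap ∘ₗ g.toLinearMap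
    rw [hg, hg', errorOp_comp_errorOp (h ha' b hb), errorOp_comp_errorOp (h ha b' hb'),
      add_comm a, add_comm b]
  · rw [mem_cssCode_iff_errorOp]
    constructor
    · rintro hv g ⟨a, ha, b, hb, hg⟩
      exact (LinearMap.congr_fun hg v).trans (hv a ha b hb)
    · intro hv a ha b hb
      obtain ⟨g, hgS, hg⟩ := exists_cssStabilizer h ha hb
      exact (LinearMap.congr_fun hg v).symm.trans (hv g hgS)

/-- An error with shift part outside `B^⊥` or phase part outside `A^⊥` maps the code to its
orthogonal complement. -/
theorem inner_errorOp_eq_zero {a b : Fin n → F}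
    (hab : ¬ (a ∈ dualCode B ∧ b ∈ dualCode A)) {u v : QuditSpace F n}
    (hu : u ∈ cssCode A B) (hv : v ∈ cssCode A B) : inner ℂ u (errorOp a b v) = 0 := by
  rw [PiLp.inner_apply]
  simp only [errorOp_apply, RCLike.inner_apply]
  by_cases ha : a ∈ dualCode B
  · obtain ⟨s, hs, hne⟩ := exists_traceChar_dotProduct_ne_one fun hb => hab ⟨ha, hb⟩
    -- Translating the summation index by `s ∈ A` multiplies the sum by `ω ^ tr(b ⬝ s) ≠ 1`.
    set g : (Fin n → F) → ℂ := fun x =>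
      traceChar F (b ⬝ᵥ (x - a)) * v (x - a) * (starRingEnd ℂ) (u x) with hg
    have hshift : ∀ x, g (x + s) = traceChar F (s ⬝ᵥ b) * g x := by
      intro x
      have hvs := hv.1 s hs (x + s - a)
      have hus := hu.1 s hs (x + s)
      rw [add_sub_cancel_right] at hus
      have h₁ : x + s - a - s = x - a := by abel
      have h₂ : x + s - a = s + (x - a) := by abel
      rw [h₁] at hvs
      simp only [hg]
      rw [← hvs, ← hus, h₂, dotProduct_add, traceChar_add, dotProduct_comm b s]
      ring
    have hsum : ∑ x, g x = traceChar F (s ⬝ᵥ b) * ∑ x, g x := by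
      rw [Finset.mul_sum, ← Finset.sum_congr rfl fun x _ => hshift x]
      exact (Equiv.sum_comp (Equiv.addRight s) g).symm
    by_contra h0
    exact hne (mul_right_cancel₀ h0 (hsum.symm.trans (one_mul _).symm))
  · refine Finset.sum_eq_zero fun x _ => ?_
    by_cases hx : x ∈ dualCode B
    · rw [hv.2 (x - a) fun hxa => ha (by simpa using (dualCode B).sub_mem hx hxa)]
      simp
    · rw [hu.2 x hx]
      simp

theorem IsHarmful.ne_zero {Q : Submodule ℂ (QuditSpace F n)} {a b : Fin n → F}
    (hab : IsHarmful Q a b) : a ≠ 0 ∨ b ≠ 0 := by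
  rcases hab with ⟨-, hdet⟩ | ⟨-, hne, -⟩
  · by_contra! h0
    refine hdet ⟨1, fun u _ v _ => ?_⟩
    rw [h0.1, h0.2, errorOp_zero_zero, LinearMap.id_apply, one_mul]
  · exact hne

theorem IsHarmful.mem_dualCode {a b : Fin n → F}
    (hab : IsHarmful (cssCode A B) a b) : a ∈ dualCode B ∧ b ∈ dualCode A := by
  by_contra hnot
  rcases hab with ⟨-, hdet⟩ | ⟨-, -, u, hu, v, hv, huv⟩
  · exact hdet ⟨0, fun u hu v hv => by rw [inner_errorOp_eq_zero hnot hu hv, zero_mul]⟩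
  · exact huv (inner_errorOp_eq_zero hnot hu hv)

/-- If the nonzero words of `A^⊥` and `B^⊥` have weight at least `d`, then the
Calderbank-Shor-Steane code of `A` and `B` has minimum distance at least `d`. -/
theorem le_quantumMinDist_cssCode [DecidableEq F] {d : ℕ}
    (hA : ∀ x ∈ dualCode A, x ≠ 0 → d ≤ hammingNorm x)
    (hB : ∀ x ∈ dualCode B, x ≠ 0 → d ≤ hammingNorm x) :
    (d : ℕ∞) ≤ quantumMinDist (cssCode A B) := by
  refine le_iInf fun a => le_iInf fun b => le_iInf fun hab => ?_
  obtain ⟨ha, hb⟩ := IsHarmful.mem_dualCode hab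
  rw [Nat.cast_le]
  rcases hab.ne_zero with h0 | h0
  · exact (hB a ha h0).trans
      (Finset.card_le_card (Finset.monotone_filter_right _ fun i _ hi => Or.inl hi))
  · exact (hA b hb h0).trans
      (Finset.card_le_card (Finset.monotone_filter_right _ fun i _ hi => Or.inr hi))

end CSS

/-! ### Stabilizer codes from codewords of the puncture code -/

/-- The punctured code construction: given nested codes `C₁ ⊆ C₂`, a word `c` with
`c * C₁ ⊆ C₂` yields a stabilizer code on the support of `c`. -/
theorem exists_stabilizerCode_of_mul_mem {F ι : Type*} [Field F] [Fintype F] [DecidableEq F]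
    [Fintype ι] (C₁ C₂ : Submodule F (ι → F)) {c : ι → F}
    (hc : ∀ a ∈ C₁, a * c ∈ C₂) {d : ℕ}
    (h₁ : ∀ x ∈ dualCode C₁, x ≠ 0 → d ≤ hammingNorm x)
    (h₂ : ∀ x ∈ C₂, x ≠ 0 → d ≤ hammingNorm x) :
    ∃ (k : ℕ) (d' : ℕ∞),
      (Module.finrank F C₂ : ℤ) - Module.finrank F C₁ - Fintype.card ι + hammingNorm c ≤ k ∧
      (d : ℕ∞) ≤ d' ∧ ExistsStabilizerCode F (hammingNorm c) k d' := by
  classical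
  -- `e` enumerates the support of `c`.
  let σ : Fin (hammingNorm c) ≃ {i // i ∈ Finset.univ.filter fun i => c i ≠ 0} :=
    (Finset.equivFin _).symm
  let e : Fin (hammingNorm c) ↪ ι := σ.toEmbedding.trans (Function.Embedding.subtype _)
  have hce : ∀ j, c (e j) ≠ 0 := fun j => (Finset.mem_filter.1 (σ j).2).2
  have hsupp : ∀ i, c i ≠ 0 → ∃ j, e j = i := fun i hi =>
    ⟨σ.symm ⟨i, by simpa using hi⟩, by simp [e]⟩
  let res : (ι → F) →ₗ[F] (Fin (hammingNorm c) → F) := LinearMap.funLeft F F e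
  let A := C₁.map (res ∘ₗ LinearMap.mulRight F c)
  let B := (dualCode C₂).map res
  have hAB : A ≤ dualCode B := by
    rintro _ ⟨a, ha, rfl⟩ _ ⟨b, hb, rfl⟩
    have h0 := hb _ (hc a ha)
    rw [dotProduct_comm] at h0
    rw [← h0]
    refine Fintype.sum_of_injective e e.injective _ _ (fun i hi => ?_) fun j => rfl
    have : c i = 0 := by
      by_contra hci
      exact hi (hsupp i hci)
    simp [this]
  have hext : ∀ x : Fin (hammingNorm c) → F, x ≠ 0 → Function.extend e x 0 ≠ 0 := by
    intro x hx h0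
    rw [← hammingNorm_pos_iff, ← hammingNorm_extend_zero e, h0, hammingNorm_zero] at hx
    exact hx.false
  refine ⟨_, _, ?_, le_quantumMinDist_cssCode ?_ ?_,
    cssCode A B, isStabilizerCode_cssCode hAB, finrank_cssCode hAB, rfl⟩
  · have hA : Module.finrank F A ≤ Module.finrank F C₁ := Submodule.finrank_map_le _ _
    have hB : Module.finrank F B ≤ Module.finrank F (dualCode C₂) := Submodule.finrank_map_le _ _
    have := finrank_add_finrank_dualCode C₂
    omega
  · intro x hx h0
    -- Rescaling a word orthogonal to `A` by `c` gives a word that extends to `C₁^⊥`.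
    set y : Fin (hammingNorm c) → F := fun j => c (e j) * x j with hy
    have hnorm : hammingNorm y = hammingNorm x := by
      unfold hammingNorm
      congr 1
      ext j
      simp [hy, hce j]
    rw [← hnorm, ← hammingNorm_extend_zero e]
    refine h₁ _ (extend_mem_dualCode e fun a ha => ?_) (hext y ?_)
    · rw [← hx _ ⟨a, ha, rfl⟩]
      exact Finset.sum_congr rfl fun j _ => (mul_assoc _ _ _).symm
    · rw [← hammingNorm_ne_zero_iff, hnorm]
      exact hammingNorm_ne_zero_iff.2 h0
  · intro x hx h0
    rw [← hammingNorm_extend_zero e]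
    refine h₂ _ ?_ (hext x h0)
    rw [← dualCode_dualCode C₂]
    exact extend_mem_dualCode e fun b hb => hx _ ⟨b, hb, rfl⟩

theorem theorem3 {F : Type*} [Field F] [Fintype F] [DecidableEq F] (m ν₁ ν₂ μ : ℕ)
    (h12 : ν₁ ≤ ν₂) (h2 : ν₂ + 1 ≤ m * (Fintype.card F - 1)) (hμ : μ ≤ ν₂ - ν₁) :
    (∀ r : ℕ, (∃ c ∈ grmCode F m μ, hammingNorm c = r) →
      ∃ (k : ℕ) (d : ℕ∞),
        (grmDim F m ν₂ : ℤ) - grmDim F m ν₁ - (Fintype.card F : ℤ) ^ m + r ≤ k ∧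
        ((min (grmDist F m ν₂) (grmDist F m (grmDualOrder F m ν₁)) : ℕ) : ℕ∞) ≤ d ∧
        ExistsStabilizerCode F r k d) ∧
    (∃ (k : ℕ) (d : ℕ∞),
        (grmDim F m ν₂ : ℤ) - grmDim F m ν₁ - (Fintype.card F : ℤ) ^ m + grmDist F m μ ≤ k ∧
        ((min (grmDist F m ν₂) (grmDist F m (grmDualOrder F m ν₁)) : ℕ) : ℕ∞) ≤ d ∧
        ExistsStabilizerCode F (grmDist F m μ) k d) := by
  refine (and_iff_left_of_imp fun H => H _ (exists_mem_grmCode_hammingNorm_eq_grmDist μ)).2 ?_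
  rintro _ ⟨c, hc, rfl⟩
  have key := exists_stabilizerCode_of_mul_mem (grmCode F m ν₁) (grmCode F m ν₂) (c := c)
    (d := min (grmDist F m ν₂) (grmDist F m (grmDualOrder F m ν₁)))
    (fun a ha => mul_mem_grmCode (by omega) ha hc)
    (fun x hx h0 => (min_le_right _ _).trans
      (codeMinDist_le (dualCode_grmCode_le (by omega) hx) h0))
    (fun x hx h0 => (min_le_left _ _).trans (codeMinDist_le hx h0))
  simpa [grmDim] using key
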